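/- **Theorem 3.3.** Let $(b_j)_{j\ge 0}$ and $(w_i)_{i\ge 1}$ be real numbers with $b_j\ge 0$ for $j\ne 1$, $0<-b_1=\sum_{j\neq 1}b_j<\infty$ and $w_i>0$ for $i\ge 1$. Let $Q=(q_{ij})_{i,j\in\mathbb Z_+}$ be the weighted branching $Q$-matrix, $q_{ij}=w_ib_{j-i+1}$ if $i\ge 1$, $j\ge i-1$, and $q_{ij}=0$ otherwise, and assume that $Q$ is regular (its Feller minimal $Q$-function is honest). Let $\rho$ be the minimal nonnegative root of $B(u)=\sum_{j\ge 0}b_ju^j=0$, and suppose that $\rho<1$. Let $m\in\mathbb Z_+$ with $b_m>0$ (so $m\neq 1$), and let $\tilde Q_m$ be the $Q$-matrix on $\mathbb Z_+^2$ with $$q_{(i,k),(j,l)}=\begin{cases} w_ib_{j-i+1}, & i\ge 1,\ j\ge i-1,\ j-i+1\ne m,\ l=k,\\ w_ib_{m}, & i\ge 1,\ j=i-1+m,\ l=k+1,\\ 0,&\text{otherwise.}\end{cases}$$ Let $(X(t),Y_m(t))_{t\ge 0}$ be a $\tilde Q_m$-process with $(X(0),Y_m(0))=(1,0)$ almost surely,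 that is, a continuous-time Markov chain on $\mathbb Z_+^2$ with almost surely right-continuous paths, whose transition function $P(t)$ is standard and satisfies $P'(0)=\tilde Q_m$ entrywise; thus $Y_m(t)$ counts the jumps of $X$ of size $m-1$ up to time $t$. Let $\tau=\inf\{t\ge 0: X(t)=0\}$, with $\inf\emptyset=\infty$, be the extinction time, and write $Y_m(\infty)=\lim_{t\to\infty}Y_m(t)$. Then $P(\tau=\infty)>0$ and $$P\bigl(Y_m(\infty)=\infty \,\big|\, \tau=\infty\bigr)=1 .$$ -/

import Mathlib

open Filter Topology MeasureTheory ProbabilityTheory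
open scoped NNReal ENNReal

namespace WMB

noncomputable section

/-- The conditions on the branching rates `b` and the weights `w`:
`b j ≥ 0` for `j ≠ 1`, `0 < -b 1 = ∑_{j ≠ 1} b j < ∞`, and `w i > 0` for `i ≥ 1`.
(The value `w 0` is never used.) -/
structure IsWMBData (w b : ℕ → ℝ) : Prop where
  rate_nonneg : ∀ j, j ≠ 1 → 0 ≤ b j
  neg_rate_one_pos : 0 < -b 1
  hasSum_rate : HasSum (fun j => if j = 1 then 0 else b j) (-b 1)
  weight_pos : ∀ i, 1 ≤ i → 0 < w i

/-- The weighted branching `Q`-matrix on `ℕ`: `q i j = w i * b (j - i + 1)` for `i ≥ 1` and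
`j ≥ i - 1`, and `0` otherwise. -/
def wmbQ (w b : ℕ → ℝ) (i j : ℕ) : ℝ :=
  if 1 ≤ i ∧ i ≤ j + 1 then w i * b (j + 1 - i) else 0

/-- The augmented `Q`-matrix on `ℕ × ℕ`. The first coordinate moves as for the weighted branching
`Q`-matrix, and the second coordinate goes up by one exactly at the jumps of the first coordinate
of size `m - 1` (those with `j - i + 1 = m`), and is otherwise unchanged. -/
def augQ (w b : ℕ → ℝ) (m : ℕ) (x y : ℕ × ℕ) : ℝ :=
  if 1 ≤ x.1 ∧ x.1 ≤ y.1 + 1 ∧ y.2 = (if y.1 + 1 - x.1 = m then x.2 + 1 else x.2) then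
    w x.1 * b (y.1 + 1 - x.1)
  else 0

section Chains

variable {S : Type*} [DecidableEq S]

/-- A standard (possibly substochastic) transition function on a discrete state space. -/
structure IsTransitionFunction (P : ℝ≥0 → S → S → ℝ) : Prop where
  nonneg : ∀ t x y, 0 ≤ P t x y
  summable : ∀ t x, Summable (P t x)
  sum_le_one : ∀ t x, ∑' y, P t x y ≤ 1
  zero : ∀ x y, P 0 x y = if x = y then 1 else 0
  chapman_kolmogorov : ∀ s t x y, P (s + t) x y = ∑' z, P s x z * P t z y
  standard : ∀ x, Tendsto (fun t => P t x x) (𝓝[>] 0) (𝓝 1)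

/-- `P` is a `Q`-function for the matrix `q`: a standard transition function whose
derivative at time `0` is `q`. -/
structure IsQFunction (q : S → S → ℝ) (P : ℝ≥0 → S → S → ℝ) : Prop
    extends IsTransitionFunction P where
  deriv_zero : ∀ x y,
    Tendsto (fun t : ℝ≥0 => (P t x y - if x = y then 1 else 0) / (t : ℝ)) (𝓝[>] 0) (𝓝 (q x y))

/-- Feller's iterates for the `Q`-matrix `q`: `minimalIter q n i j t` is the probability that the
minimal chain started from `i` is at `j` at time `t` after fewer than `n` jumps, computed by
decomposing at the time `s` of the first jump. Here `-q i i` is the rate of leaving `i`. -/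
def minimalIter (q : S → S → ℝ) : ℕ → S → S → ℝ → ℝ≥0∞
  | 0 => fun _ _ _ => 0
  | n + 1 => fun i j t =>
      (if i = j then ENNReal.ofReal (Real.exp (q i i * t)) else 0) +
        ∑' k, if k = i then 0 else
          ∫⁻ s in Set.Icc 0 t,
            ENNReal.ofReal (Real.exp (q i i * s) * q i k) * minimalIter q n k j (t - s)

/-- Feller's minimal `Q`-function of `q`. -/
def minimalQFunction (q : S → S → ℝ) (t : ℝ) (i j : S) : ℝ≥0∞ :=
  ⨆ n, minimalIter q n i j t

/-- The `Q`-matrix `q` is regular (non-explosive): its minimal `Q`-function is honest. -/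
def IsRegular (q : S → S → ℝ) : Prop :=
  ∀ t : ℝ, 0 ≤ t → ∀ i, ∑' j, minimalQFunction q t i j = 1

/-- Under `μ`, the process `Z` is a time-homogeneous Markov chain in continuous time on the
discrete state space `S`, with transition function `P` and almost surely right-continuous paths. -/
structure IsMarkovChain {Ω : Type*} [MeasurableSpace Ω] [MeasurableSpace S] [TopologicalSpace S]
    (μ : Measure Ω) (P : ℝ≥0 → S → S → ℝ) (Z : ℝ≥0 → Ω → S) : Prop where
  measurable : ∀ t, Measurable (Z t)
  markov : ∀ (n : ℕ) (t : ℕ → ℝ≥0) (x : ℕ → S), Monotone t →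
    μ.real {ω | ∀ k ≤ n + 1, Z (t k) ω = x k} =
      μ.real {ω | ∀ k ≤ n, Z (t k) ω = x k} * P (t (n + 1) - t n) (x n) (x (n + 1))
  rightContinuous : ∀ᵐ ω ∂μ, ∀ t, ContinuousWithinAt (fun s => Z s ω) (Set.Ici t) t

end Chains

/-- The extinction time `inf {t ≥ 0 | X t = 0}`, equal to `∞` if `X` never vanishes. -/
def extinctionTime {Ω : Type*} (X : ℝ≥0 → Ω → ℕ) (ω : Ω) : ℝ≥0∞ :=
  ⨅ (t : ℝ≥0) (_ : X t ω = 0), (t : ℝ≥0∞)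

end

end WMB

/-! Regularity pins down the law of the first coordinate. Every `Q`-function `P` of `augQ` satisfies
the backward integral inequality, so Feller's iterates for `wmbQ` are dominated by the `P`-mass of
the states `(j, l)` with `l` at least the initial count (`minimalIter_le_act`). The minimal
`Q`-function is honest and `P` is substochastic, so no mass is left over: the first coordinate has
the minimal law (`tsum_eq_minimalQFunction`) and the count never decreases (`eq_zero_of_snd_lt`).

Survival: `B(ρ) = 0` makes `i ↦ ρ ^ i` harmonic for `wmbQ`, so the chain started at `1` is extinct
by any given time with probability at most `ρ < 1` (`minimalIter_zero_le_pow`).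

Divergence: the probability of being alive with count at most `N` decreases in time. Its limit `f`,
as a function of the starting state, is invariant under `P`, hence harmonic, and vanishes at first
coordinate `0` and at counts above `N`. If `f` vanishes at level `k + 1`, the marked jumps from
level `k` contribute nothing, so `M = sup f(·, k)` satisfies `M (-b 1) ≤ M (-b 1 - b m)`, and `M =
0` because `b m > 0`. Descending through the levels gives `f = 0` (`eq_zero_of_harmonic`).

Conditioning on a null event gives the zero measure, so the value `1` in the conclusion also
contains the positivity of the survival probability. -/

namespace WMB

noncomputable section

/-! ### Transition semigroups acting on functions with values in `[0, 1]` -/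

section Semigroup

variable {S : Type*}

/-- The action of a transition function on a function on the state space. -/
def act (P : ℝ≥0 → S → S → ℝ) (t : ℝ≥0) (f : S → ℝ) (x : S) : ℝ := ∑' y, P t x y * f y

variable [DecidableEq S] {P : ℝ≥0 → S → S → ℝ} {f : S → ℝ}

namespace IsTransitionFunction

lemma summable_act (hP : IsTransitionFunction P) (hf : ∀ x, f x ∈ Set.Icc (0 : ℝ) 1)
    (t : ℝ≥0) (x : S) : Summable fun y => P t x y * f y :=
  (hP.summable t x).of_nonneg_of_le (fun y => mul_nonneg (hP.nonneg t x y) (hf y).1)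
    fun y => mul_le_of_le_one_right (hP.nonneg t x y) (hf y).2

lemma act_mem (hP : IsTransitionFunction P) (hf : ∀ x, f x ∈ Set.Icc (0 : ℝ) 1)
    (t : ℝ≥0) (x : S) : act P t f x ∈ Set.Icc (0 : ℝ) 1 :=
  ⟨tsum_nonneg fun y => mul_nonneg (hP.nonneg t x y) (hf y).1,
    ((hP.summable_act hf t x).tsum_le_tsum
      (fun y => mul_le_of_le_one_right (hP.nonneg t x y) (hf y).2) (hP.summable t x)).trans
      (hP.sum_le_one t x)⟩

lemma act_mono (hP : IsTransitionFunction P) {g : S → ℝ} (hf : ∀ x, f x ∈ Set.Icc (0 : ℝ) 1)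
    (hg : ∀ x, g x ∈ Set.Icc (0 : ℝ) 1) (hfg : ∀ x, f x ≤ g x) (t : ℝ≥0) (x : S) :
    act P t f x ≤ act P t g x :=
  (hP.summable_act hf t x).tsum_le_tsum
    (fun y => mul_le_mul_of_nonneg_left (hfg y) (hP.nonneg t x y)) (hP.summable_act hg t x)

lemma act_zero (hP : IsTransitionFunction P) (x : S) : act P 0 f x = f x := by
  simp [act, hP.zero]

lemma act_add (hP : IsTransitionFunction P) (hf : ∀ x, f x ∈ Set.Icc (0 : ℝ) 1)
    (s t : ℝ≥0) (x : S) : act P (s + t) f x = act P s (act P t f) x := by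
  have hsum : Summable fun p : S × S => P s x p.1 * (P t p.1 p.2 * f p.2) := by
    have h0 : ∀ p : S × S, 0 ≤ P s x p.1 * (P t p.1 p.2 * f p.2) := fun p =>
      mul_nonneg (hP.nonneg s x p.1) (mul_nonneg (hP.nonneg t p.1 p.2) (hf p.2).1)
    refine (summable_prod_of_nonneg h0).2 ⟨fun z => ?_, ?_⟩
    · exact (hP.summable_act hf t z).mul_left (P s x z)
    simp only [tsum_mul_left]
    exact hP.summable_act (f := act P t f) (fun z => hP.act_mem hf t z) s x
  calc act P (s + t) f x = ∑' y, ∑' z, P s x z * (P t z y * f y) := by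
        refine tsum_congr fun y => ?_
        rw [hP.chapman_kolmogorov, ← tsum_mul_right]
        exact tsum_congr fun z => mul_assoc _ _ _
    _ = ∑' z, ∑' y, P s x z * (P t z y * f y) :=
        (Summable.tsum_comm (f := fun z y => P s x z * (P t z y * f y)) hsum)
    _ = act P s (act P t f) x := tsum_congr fun z => tsum_mul_left

lemma act_eq_add (hP : IsTransitionFunction P) (hf : ∀ x, f x ∈ Set.Icc (0 : ℝ) 1)
    (t : ℝ≥0) (x : S) :
    act P t f x = P t x x * f x + ∑' y, if y = x then 0 else P t x y * f y :=
  (hP.summable_act hf t x).tsum_eq_add_tsum_ite x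

lemma summable_off_diag (hP : IsTransitionFunction P) (hf : ∀ x, f x ∈ Set.Icc (0 : ℝ) 1)
    (t : ℝ≥0) (x : S) : Summable fun y => if y = x then 0 else P t x y * f y := by
  refine (hP.summable_act hf t x).of_nonneg_of_le (fun y => ?_) fun y => ?_ <;> split_ifs <;>
    first | exact le_rfl | exact mul_nonneg (hP.nonneg t x y) (hf y).1

lemma off_diag_nonneg (hP : IsTransitionFunction P) (hf : ∀ x, f x ∈ Set.Icc (0 : ℝ) 1)
    (t : ℝ≥0) (x : S) : 0 ≤ ∑' y, if y = x then 0 else P t x y * f y := by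
  refine tsum_nonneg fun y => ?_
  split_ifs
  exacts [le_rfl, mul_nonneg (hP.nonneg t x y) (hf y).1]

/-- The off-diagonal mass is shared between `f` and `1 - f`. This turns lower bounds for `1 - f`
into upper bounds for `f`. -/
lemma off_diag_add_le (hP : IsTransitionFunction P) (hf : ∀ x, f x ∈ Set.Icc (0 : ℝ) 1)
    (t : ℝ≥0) (x : S) :
    (∑' y, if y = x then 0 else P t x y * f y) + (∑' y, if y = x then 0 else P t x y * (1 - f y))
      ≤ 1 - P t x x := by
  have hf' : ∀ y, 1 - f y ∈ Set.Icc (0 : ℝ) 1 := fun y =>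
    ⟨by linarith [(hf y).2], by linarith [(hf y).1]⟩
  rw [← (hP.summable_off_diag hf t x).tsum_add (hP.summable_off_diag hf' t x)]
  have h := hP.sum_le_one t x
  rw [(hP.summable t x).tsum_eq_add_tsum_ite x] at h
  have : ∀ y, ((if y = x then 0 else P t x y * f y) + if y = x then 0 else P t x y * (1 - f y)) =
      if y = x then 0 else P t x y := by
    intro y; split_ifs <;> ring
  simp only [this]
  linarith

lemma off_diag_le (hP : IsTransitionFunction P) (hf : ∀ x, f x ∈ Set.Icc (0 : ℝ) 1)
    (t : ℝ≥0) (x : S) : (∑' y, if y = x then 0 else P t x y * f y) ≤ 1 - P t x x := by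
  have := hP.off_diag_add_le hf t x
  have := hP.off_diag_nonneg (f := fun y => 1 - f y)
    (fun y => ⟨by linarith [(hf y).2], by linarith [(hf y).1]⟩) t x
  linarith

lemma le_one (hP : IsTransitionFunction P) (t : ℝ≥0) (x y : S) : P t x y ≤ 1 :=
  ((hP.summable t x).le_tsum y fun z _ => hP.nonneg t x z).trans (hP.sum_le_one t x)

/-- The loss on the diagonal and the gain off it both lie in `[0, 1 - P t x x]` and enter with
opposite signs. The bound does not involve `f`, so it also applies to `act P s f`, which gives
continuity in time. -/
lemma abs_act_sub_le (hP : IsTransitionFunction P) (hf : ∀ x, f x ∈ Set.Icc (0 : ℝ) 1)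
    (t : ℝ≥0) (x : S) : |act P t f x - f x| ≤ 1 - P t x x := by
  rw [hP.act_eq_add hf, abs_le]
  have h1 := hP.off_diag_le hf t x
  have h2 := hP.off_diag_nonneg hf t x
  have h3 := hP.le_one t x x
  have h4 := mul_nonneg (sub_nonneg.2 h3) (hf x).1
  have h5 := mul_nonneg (sub_nonneg.2 h3) (sub_nonneg.2 (hf x).2)
  constructor <;> nlinarith

lemma tendsto_diag (hP : IsTransitionFunction P) (x : S) :
    Tendsto (fun t => P t x x) (𝓝 0) (𝓝 1) := by
  have h : ContinuousWithinAt (fun t => P t x x) (Set.Ioi 0) 0 := by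
    have := hP.standard x
    rwa [ContinuousWithinAt, hP.zero, if_pos rfl]
  rw [continuousWithinAt_Ioi_iff_Ici] at h
  have h0 : Set.Ici (0 : ℝ≥0) = Set.univ := Set.eq_univ_of_forall fun t => zero_le (a := t)
  rw [h0, continuousWithinAt_univ, ContinuousAt, hP.zero, if_pos rfl] at h
  exact h

lemma continuous_act (hP : IsTransitionFunction P) (hf : ∀ x, f x ∈ Set.Icc (0 : ℝ) 1) (x : S) :
    Continuous fun t => act P t f x := by
  have key : ∀ s r : ℝ≥0, |act P (r + s) f x - act P s f x| ≤ 1 - P r x x := fun s r => by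
    rw [hP.act_add hf]
    exact hP.abs_act_sub_le (fun z => hP.act_mem hf s z) r x
  have key2 : ∀ s t : ℝ≥0, |act P t f x - act P s f x| ≤ 1 - P (nndist t s) x x := by
    intro s t
    rcases le_total s t with h | h
    · obtain ⟨r, rfl⟩ := exists_add_of_le h
      have : nndist (s + r) s = r := by
        ext; simp [NNReal.dist_eq]
      rw [this, add_comm s r]
      exact key s r
    · obtain ⟨r, rfl⟩ := exists_add_of_le h
      have : nndist t (t + r) = r := by
        ext; simp [NNReal.dist_eq]
      rw [this, abs_sub_comm, add_comm t r]
      exact key t r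
  rw [continuous_iff_continuousAt]
  intro s
  rw [ContinuousAt, tendsto_iff_dist_tendsto_zero]
  have hd : Tendsto (fun t : ℝ≥0 => nndist t s) (𝓝 s) (𝓝 0) := by
    have : Continuous fun t : ℝ≥0 => nndist t s := by fun_prop
    simpa using this.tendsto s
  refine squeeze_zero (fun _ => dist_nonneg) (fun t => ?_)
    (g := fun t => 1 - P (nndist t s) x x) ?_
  · rw [Real.dist_eq]; exact key2 s t
  · simpa using ((hP.tendsto_diag x).comp hd).const_sub 1

end IsTransitionFunction

/-- The state `x` is conservative for `q`: its off-diagonal rates are nonnegative and sum up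
to `-q x x`. -/
structure IsConservativeAt (q : S → S → ℝ) (x : S) : Prop where
  nonneg : ∀ y, y ≠ x → 0 ≤ q x y
  hasSum : HasSum (fun y => if y = x then 0 else q x y) (-q x x)

/-- The rate of change of `f` due to jumps out of `x`, without the loss term. -/
def gain (q : S → S → ℝ) (f : S → ℝ) (x : S) : ℝ := ∑' y, if y = x then 0 else q x y * f y

variable {q : S → S → ℝ}

lemma IsConservativeAt.summable_gain {x : S} (hq : IsConservativeAt q x)
    (hf : ∀ x, f x ∈ Set.Icc (0 : ℝ) 1) :
    Summable fun y => if y = x then 0 else q x y * f y := by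
  refine hq.hasSum.summable.of_nonneg_of_le (fun y => ?_) fun y => ?_ <;> split_ifs with h
  · exact le_rfl
  · exact mul_nonneg (hq.nonneg y h) (hf y).1
  · exact le_rfl
  · exact mul_le_of_le_one_right (hq.nonneg y h) (hf y).2

lemma IsConservativeAt.gain_one_sub {x : S} (hq : IsConservativeAt q x)
    (hf : ∀ x, f x ∈ Set.Icc (0 : ℝ) 1) :
    gain q (fun y => 1 - f y) x = -q x x - gain q f x := by
  rw [gain, gain, ← hq.hasSum.tsum_eq, ← hq.hasSum.summable.tsum_sub (hq.summable_gain hf)]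
  refine tsum_congr fun y => ?_
  split_ifs <;> ring

/-! ### Pointwise generator and the backward inequality -/

namespace IsQFunction

lemma tendsto_exit (hP : IsQFunction q P) (x : S) :
    Tendsto (fun r : ℝ≥0 => (1 - P r x x) / (r : ℝ)) (𝓝[>] 0) (𝓝 (-q x x)) := by
  refine (hP.deriv_zero x x).neg.congr fun r => ?_
  simp only [if_true]
  ring

/-- A Fatou argument: a finite partial sum of `gain` already exceeds `a`, and finite sums pass to
the limit. -/
lemma eventually_lt_off_diag (hP : IsQFunction q P) {x : S} (hq : IsConservativeAt q x)
    (hf : ∀ x, f x ∈ Set.Icc (0 : ℝ) 1) {a : ℝ} (ha : a < gain q f x) :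
    ∀ᶠ r : ℝ≥0 in 𝓝[>] 0, a < (∑' y, if y = x then 0 else P r x y * f y) / (r : ℝ) := by
  obtain ⟨F, hF⟩ := ((hq.summable_gain hf).hasSum.eventually (lt_mem_nhds ha)).exists
  have hlim : Tendsto (fun r : ℝ≥0 => ∑ y ∈ F, (if y = x then 0 else P r x y * f y) / (r : ℝ))
      (𝓝[>] 0) (𝓝 (∑ y ∈ F, if y = x then 0 else q x y * f y)) := by
    refine tendsto_finsetSum F fun y _ => ?_
    by_cases h : y = x
    · simp [h]
    · simp only [h, if_false]
      refine ((hP.deriv_zero x y).mul_const (f y)).congr fun r => ?_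
      rw [if_neg (Ne.symm h)]
      ring
  filter_upwards [hlim.eventually (lt_mem_nhds hF)] with r hr
  refine hr.trans_le ?_
  rw [← Finset.sum_div]
  refine div_le_div_of_nonneg_right ?_ r.2
  refine (hP.toIsTransitionFunction.summable_off_diag hf r x).sum_le_tsum F fun y _ => ?_
  split_ifs
  exacts [le_rfl, mul_nonneg (hP.nonneg r x y) (hf y).1]

/-- The upper bound is the Fatou bound for `1 - f`: at a conservative state the two gains add up to
the exit rate, so no mass escapes in the limit. -/
lemma tendsto_off_diag (hP : IsQFunction q P) {x : S} (hq : IsConservativeAt q x)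
    (hf : ∀ x, f x ∈ Set.Icc (0 : ℝ) 1) :
    Tendsto (fun r : ℝ≥0 => (∑' y, if y = x then 0 else P r x y * f y) / (r : ℝ)) (𝓝[>] 0)
      (𝓝 (gain q f x)) := by
  have hf' : ∀ y, 1 - f y ∈ Set.Icc (0 : ℝ) 1 := fun y =>
    ⟨by linarith [(hf y).2], by linarith [(hf y).1]⟩
  refine tendsto_order.2 ⟨fun a ha => hP.eventually_lt_off_diag hq hf ha, fun a ha => ?_⟩
  have h1 : gain q (fun y => 1 - f y) x - (a - gain q f x) / 2 < gain q (fun y => 1 - f y) x := by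
    linarith
  have h2 : -q x x < -q x x + (a - gain q f x) / 2 := by linarith
  filter_upwards [hP.eventually_lt_off_diag hq hf' h1,
    (hP.tendsto_exit x).eventually (gt_mem_nhds h2)] with r hr1 hr2
  have h3 := div_le_div_of_nonneg_right
    (hP.toIsTransitionFunction.off_diag_add_le hf r x) r.2
  rw [add_div] at h3
  rw [hq.gain_one_sub hf] at hr1
  simp only [NNReal.val_eq_coe] at h3
  linarith

/-- Every bounded function is in the domain of the pointwise generator at conservative states. -/
lemma tendsto_act_sub_div (hP : IsQFunction q P) {x : S} (hq : IsConservativeAt q x)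
    (hf : ∀ x, f x ∈ Set.Icc (0 : ℝ) 1) :
    Tendsto (fun r : ℝ≥0 => (act P r f x - f x) / (r : ℝ)) (𝓝[>] 0)
      (𝓝 (q x x * f x + gain q f x)) := by
  have h := ((hP.tendsto_exit x).mul_const (-f x)).add (hP.tendsto_off_diag hq hf)
  rw [neg_mul_neg] at h
  refine h.congr fun r => ?_
  rw [hP.toIsTransitionFunction.act_eq_add hf]
  ring

/-- The small increment is put on the left in the semigroup law, so the generator acts at the
starting state on the bounded function `act P t f`. -/
lemma hasDerivWithinAt_act (hP : IsQFunction q P) {x : S} (hq : IsConservativeAt q x)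
    (hf : ∀ x, f x ∈ Set.Icc (0 : ℝ) 1) (t : ℝ≥0) :
    HasDerivWithinAt (fun s : ℝ => act P s.toNNReal f x)
      (q x x * act P t f x + gain q (act P t f) x) (Set.Ioi t) t := by
  rw [hasDerivWithinAt_iff_tendsto_slope' (by simp)]
  have h := hP.tendsto_act_sub_div hq (fun z => hP.toIsTransitionFunction.act_mem hf t z)
  have hc : Tendsto (fun s : ℝ => (s - t).toNNReal) (𝓝[>] (t : ℝ)) (𝓝[>] 0) := by
    refine tendsto_nhdsWithin_iff.2 ⟨?_, ?_⟩
    · have : Continuous fun s : ℝ => (s - t).toNNReal := by fun_prop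
      simpa using (this.tendsto (t : ℝ)).mono_left nhdsWithin_le_nhds
    · filter_upwards [self_mem_nhdsWithin] with s hs
      simpa using hs
  refine (h.comp hc).congr' ?_
  filter_upwards [self_mem_nhdsWithin] with s hs
  have hs' : (t : ℝ) < s := hs
  have h1 : s.toNNReal = (s - t).toNNReal + t := by
    ext
    rw [NNReal.coe_add, Real.coe_toNNReal _ (t.2.trans hs'.le), Real.coe_toNNReal _ (by linarith)]
    ring
  simp only [Function.comp_apply, slope_def_field]
  rw [h1, hP.toIsTransitionFunction.act_add hf, Real.coe_toNNReal _ (by linarith),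
    Real.toNNReal_coe]

/-- The backward integral inequality, for finitely many target states of the first jump. -/
lemma backward_finset (hP : IsQFunction q P) {x : S} (hq : IsConservativeAt q x)
    (hf : ∀ x, f x ∈ Set.Icc (0 : ℝ) 1) {t : ℝ} (ht : 0 ≤ t) (F : Finset S) (hF : x ∉ F) :
    Real.exp (q x x * t) * f x +
      ∑ k ∈ F, ∫ s in (0 : ℝ)..t, Real.exp (q x x * s) * q x k * act P (t - s).toNNReal f k
      ≤ act P t.toNNReal f x := by
  have hT := hP.toIsTransitionFunction
  have hcont : ∀ k, Continuous fun s : ℝ => act P s.toNNReal f k := fun k =>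
    (hT.continuous_act hf k).comp continuous_real_toNNReal
  -- The integrating factor `exp (-q x x * s)` cancels the loss term, leaving `gain` as the right
  -- derivative; truncating it to `F` gives a continuous lower bound to integrate.
  have hint := intervalIntegral.integral_le_sub_of_hasDeriv_right_of_le
    (g := fun s : ℝ => Real.exp (-q x x * s) * act P s.toNNReal f x)
    (g' := fun s : ℝ => Real.exp (-q x x * s) * gain q (act P s.toNNReal f) x)
    (φ := fun s : ℝ => ∑ k ∈ F, Real.exp (-q x x * s) * q x k * act P s.toNNReal f k)
    ht (((by fun_prop : Continuous fun s : ℝ => Real.exp (-q x x * s)).mul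
      (hcont x)).continuousOn) ?_ ?_ ?_
  · simp only [mul_zero, Real.exp_zero, one_mul, Real.toNNReal_zero, hT.act_zero] at hint
    have hsub : ∀ k, ∫ s in (0 : ℝ)..t, Real.exp (q x x * s) * q x k * act P (t - s).toNNReal f k
        = Real.exp (q x x * t) *
          ∫ s in (0 : ℝ)..t, Real.exp (-q x x * s) * q x k * act P s.toNNReal f k := by
      intro k
      rw [← intervalIntegral.integral_const_mul]
      have := intervalIntegral.integral_comp_sub_left (a := 0) (b := t)
        (fun s => Real.exp (q x x * t) * (Real.exp (-q x x * s) * q x k * act P s.toNNReal f k)) t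
      rw [sub_self, sub_zero] at this
      rw [← this]
      refine intervalIntegral.integral_congr fun s _ => ?_
      simp only [← mul_assoc, ← Real.exp_add]
      congr 4
      ring
    rw [intervalIntegral.integral_finsetSum] at hint
    · rw [Finset.sum_congr rfl fun k _ => hsub k, ← Finset.mul_sum, ← mul_add]
      calc _ ≤ Real.exp (q x x * t) * (Real.exp (-q x x * t) * act P t.toNNReal f x) :=
            mul_le_mul_of_nonneg_left (by linarith) (Real.exp_nonneg _)
        _ = _ := by rw [← mul_assoc, ← Real.exp_add]; simp
    · intro k _
      refine Continuous.intervalIntegrable ?_ _ _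
      have := hcont k
      fun_prop
  · intro s hs
    have hs0 : 0 ≤ s := hs.1.le
    have h1 : HasDerivWithinAt (fun s : ℝ => Real.exp (-q x x * s))
        (Real.exp (-q x x * s) * -q x x) (Set.Ioi s) s := by
      have := ((hasDerivAt_id s).const_mul (-q x x)).exp
      simpa using this.hasDerivWithinAt
    have h2 := hP.hasDerivWithinAt_act hq hf s.toNNReal
    rw [Real.coe_toNNReal s hs0] at h2
    refine (h1.mul h2).congr_deriv ?_
    ring
  · refine ContinuousOn.integrableOn_Icc (Continuous.continuousOn ?_)
    refine continuous_finsetSum _ fun k _ => ?_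
    have := hcont k
    fun_prop
  · intro s hs
    have hg : ∀ z, act P s.toNNReal f z ∈ Set.Icc (0 : ℝ) 1 := fun z => hT.act_mem hf _ z
    simp only [mul_assoc, ← Finset.mul_sum]
    refine mul_le_mul_of_nonneg_left ?_ (Real.exp_nonneg _)
    have h := (hq.summable_gain hg).sum_le_tsum F fun y _ => by
      split_ifs with h
      exacts [le_rfl, mul_nonneg (hq.nonneg y h) (hg y).1]
    refine le_trans (le_of_eq (Finset.sum_congr rfl fun k hk => ?_)) h
    rw [if_neg (ne_of_mem_of_not_mem hk hF)]

/-- The backward integral inequality. -/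
lemma backward (hP : IsQFunction q P) {x : S} (hq : IsConservativeAt q x)
    (hf : ∀ x, f x ∈ Set.Icc (0 : ℝ) 1) {t : ℝ} (ht : 0 ≤ t) :
    ENNReal.ofReal (Real.exp (q x x * t) * f x) +
      ∑' k, (if k = x then 0 else ∫⁻ s in Set.Icc 0 t,
        ENNReal.ofReal (Real.exp (q x x * s) * q x k) *
          ENNReal.ofReal (act P (t - s).toNNReal f k))
      ≤ ENNReal.ofReal (act P t.toNNReal f x) := by
  have hT := hP.toIsTransitionFunction
  rw [ENNReal.tsum_eq_iSup_sum, ENNReal.add_iSup]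
  refine iSup_le fun F => ?_
  refine le_trans (le_of_eq ?_)
    (ENNReal.ofReal_le_ofReal (hP.backward_finset hq hf ht (F.erase x) (by simp)))
  have hnn : ∀ k ∈ F.erase x, ∀ s, 0 ≤ Real.exp (q x x * s) * q x k *
      act P (t - s).toNNReal f k := fun k hk s =>
    mul_nonneg (mul_nonneg (Real.exp_nonneg _) (hq.nonneg k (Finset.ne_of_mem_erase hk)))
      (hT.act_mem hf _ k).1
  have hnn' : ∀ k ∈ F.erase x, 0 ≤ ∫ s in (0 : ℝ)..t, Real.exp (q x x * s) * q x k *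
      act P (t - s).toNNReal f k := fun k hk =>
    intervalIntegral.integral_nonneg ht fun s _ => hnn k hk s
  rw [ENNReal.ofReal_add (mul_nonneg (Real.exp_nonneg _) (hf x).1) (Finset.sum_nonneg hnn'),
    ENNReal.ofReal_sum_of_nonneg hnn']
  congr 1
  refine (Finset.sum_erase F (a := x) ?_).symm.trans ?_
  · exact if_pos rfl
  refine Finset.sum_congr rfl fun k hk => ?_
  rw [if_neg (Finset.ne_of_mem_erase hk), intervalIntegral.integral_of_le ht,
    ← integral_Icc_eq_integral_Ioc, ofReal_integral_eq_lintegral_ofReal]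
  · refine lintegral_congr fun s => ?_
    rw [ENNReal.ofReal_mul (mul_nonneg (Real.exp_nonneg _)
      (hq.nonneg k (Finset.ne_of_mem_erase hk)))]
  · refine ContinuousOn.integrableOn_Icc (Continuous.continuousOn ?_)
    have : Continuous fun s : ℝ => act P (t - s).toNNReal f k :=
      (hT.continuous_act hf k).comp (by fun_prop)
    fun_prop
  · exact Eventually.of_forall fun s => hnn k hk s

/-- A state with exit rate `0` is absorbing. -/
lemma diag_eq_one (hP : IsQFunction q P) {x : S} (hx : q x x = 0) (t : ℝ≥0) : P t x x = 1 := by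
  have hT := hP.toIsTransitionFunction
  have hmul : ∀ s t, P s x x * P t x x ≤ P (s + t) x x := fun s t => by
    rw [hT.chapman_kolmogorov]
    have hs : Summable fun z => P s x z * P t z x :=
      (hT.summable s x).of_nonneg_of_le (fun z => mul_nonneg (hT.nonneg _ _ _) (hT.nonneg _ _ _))
        fun z => mul_le_of_le_one_right (hT.nonneg _ _ _) (hT.le_one _ _ _)
    exact hs.le_tsum x fun z _ => mul_nonneg (hT.nonneg _ _ _) (hT.nonneg _ _ _)
  -- Taking `r = t / n`, the right side tends to `t` times the exit rate, which is `0`.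
  have hn : ∀ (n : ℕ) (r : ℝ≥0), 1 - P (n * r) x x ≤ n * (1 - P r x x) := by
    intro n r
    induction n with
    | zero => simp [hT.zero]
    | succ n ih =>
      have h := hmul (n * r) r
      have h1 := mul_nonneg (sub_nonneg.2 (hT.le_one (n * r) x x))
        (sub_nonneg.2 (hT.le_one r x x))
      push_cast
      rw [add_mul, one_mul]
      nlinarith
  rcases eq_or_ne t 0 with rfl | ht
  · simp [hT.zero]
  refine le_antisymm (hT.le_one _ _ _) ?_
  have hlim : Tendsto (fun n : ℕ => t / ((n : ℝ≥0) + 1)) atTop (𝓝[>] 0) := by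
    refine tendsto_nhdsWithin_iff.2 ⟨?_, Eventually.of_forall fun n => ?_⟩
    · rw [← NNReal.tendsto_coe]
      push_cast
      simpa [div_eq_mul_inv] using (tendsto_one_div_add_atTop_nhds_zero_nat (𝕜 := ℝ)).const_mul t.1
    · simp only [Set.mem_Ioi]; positivity
  have h := ((hP.tendsto_exit x).comp hlim).const_mul (t : ℝ)
  rw [hx, neg_zero, mul_zero] at h
  have h2 := ge_of_tendsto' h (b := 1 - P t x x) fun n => by
    have h3 := hn (n + 1) (t / ((n : ℝ≥0) + 1))
    have h4 : ((n + 1 : ℕ) : ℝ≥0) * (t / ((n : ℝ≥0) + 1)) = t := by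
      push_cast; field_simp
    rw [h4] at h3
    refine h3.trans (le_of_eq ?_)
    have : (t : ℝ) ≠ 0 := by exact_mod_cast ht
    simp only [Function.comp_apply]
    push_cast
    field_simp
  linarith

end IsQFunction

lemma IsTransitionFunction.eq_zero_of_diag (hT : IsTransitionFunction P) {x : S} {t : ℝ≥0}
    (hx : P t x x = 1) {y : S} (hy : y ≠ x) : P t x y = 0 := by
  have h := hT.off_diag_le (f := fun _ => 1) (fun _ => by simp) t x
  rw [hx, sub_self] at h
  have h2 := (hT.summable_off_diag (f := fun _ => 1) (fun _ => by simp) t x).le_tsum y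
    fun z _ => by
      split_ifs
      exacts [le_rfl, mul_nonneg (hT.nonneg _ _ _) zero_le_one]
  rw [if_neg hy, mul_one] at h2
  exact le_antisymm (h2.trans h) (hT.nonneg _ _ _)

end Semigroup

/-! ### Rows of the two `Q`-matrices -/

/-- The state reached from `x` when the first coordinate jumps to `j`. -/
def jumpTo (m : ℕ) (x : ℕ × ℕ) (j : ℕ) : ℕ × ℕ :=
  (j, if j + 1 - x.1 = m then x.2 + 1 else x.2)

lemma jumpTo_injective (m : ℕ) (x : ℕ × ℕ) : Function.Injective (jumpTo m x) := fun _ _ h =>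
  congrArg Prod.fst h

lemma augQ_jumpTo (w b : ℕ → ℝ) (m : ℕ) (x : ℕ × ℕ) (j : ℕ) :
    augQ w b m x (jumpTo m x j) = wmbQ w b x.1 j := by
  exact if_congr (and_congr_right fun _ => and_iff_left rfl) rfl rfl

lemma augQ_eq_zero {w b : ℕ → ℝ} {m : ℕ} {x y : ℕ × ℕ} (h : y ∉ Set.range (jumpTo m x)) :
    augQ w b m x y = 0 := by
  refine if_neg fun h' => h ⟨y.1, ?_⟩
  rw [jumpTo, ← h'.2.2]

/-- Staying put corresponds to the index `1`, which is unmarked because `m ≠ 1`; hence the two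
matrices have the same diagonal. -/
lemma jumpTo_self {m : ℕ} (hm : m ≠ 1) (x : ℕ × ℕ) : jumpTo m x x.1 = x := by
  have : ¬ x.1 + 1 - x.1 = m := by omega
  simp only [jumpTo, if_neg this]

lemma jumpTo_eq_iff {m : ℕ} (hm : m ≠ 1) (x : ℕ × ℕ) (j : ℕ) : jumpTo m x j = x ↔ j = x.1 :=
  ⟨fun h => congrArg Prod.fst h, fun h => h ▸ jumpTo_self hm x⟩

lemma augQ_diag (w b : ℕ → ℝ) {m : ℕ} (hm : m ≠ 1) (x : ℕ × ℕ) :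
    augQ w b m x x = wmbQ w b x.1 x.1 := by
  rw [← augQ_jumpTo w b m x, jumpTo_self hm]

lemma wmbQ_zero (w b : ℕ → ℝ) (j : ℕ) : wmbQ w b 0 j = 0 := by simp [wmbQ]

lemma wmbQ_diag (w b : ℕ → ℝ) {i : ℕ} (hi : 1 ≤ i) : wmbQ w b i i = w i * b 1 := by
  simp [wmbQ, hi]

lemma wmbQ_succ_add (w b : ℕ → ℝ) (i j : ℕ) : wmbQ w b (i + 1) (i + j) = w (i + 1) * b j := by
  have : i + j + 1 - (i + 1) = j := by omega
  rw [wmbQ, if_pos (by omega), this]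

lemma wmbQ_succ_eq_zero {w b : ℕ → ℝ} {i j : ℕ} (h : j ∉ Set.range (i + ·)) :
    wmbQ w b (i + 1) j = 0 := by
  refine if_neg fun h' => h ⟨j - i, ?_⟩
  simp only
  omega

lemma IsWMBData.wmbQ_nonneg {w b : ℕ → ℝ} (hwb : IsWMBData w b) {i j : ℕ} (hij : j ≠ i) :
    0 ≤ wmbQ w b i j := by
  unfold wmbQ
  split_ifs with h
  · exact mul_nonneg (hwb.weight_pos i h.1).le (hwb.rate_nonneg _ (by omega))
  · exact le_rfl

/-- Off-diagonal sums over a row of the weighted branching `Q`-matrix. -/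
lemma hasSum_wmbQ_row {w b : ℕ → ℝ} {g : ℕ → ℝ} {i : ℕ} {a : ℝ}
    (h : HasSum (fun j => if j = 1 then 0 else b j * g (i + j)) a) :
    HasSum (fun j => if j = i + 1 then 0 else wmbQ w b (i + 1) j * g j) (w (i + 1) * a) := by
  rw [← (add_right_injective i).hasSum_iff]
  · refine (h.mul_left (w (i + 1))).congr_fun fun j => ?_
    have : i + j = i + 1 ↔ j = 1 := by omega
    simp only [Function.comp_apply, wmbQ_succ_add, this]
    split_ifs <;> ring
  · intro j hj
    rw [wmbQ_succ_eq_zero hj]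
    simp

lemma IsWMBData.isConservativeAt_wmbQ {w b : ℕ → ℝ} (hwb : IsWMBData w b) (i : ℕ) :
    IsConservativeAt (wmbQ w b) i := by
  refine ⟨fun j hj => hwb.wmbQ_nonneg hj, ?_⟩
  rcases i with _ | i
  · simp [wmbQ_zero, hasSum_zero]
  · have := hasSum_wmbQ_row (w := w) (g := fun _ => 1) (i := i)
      (by simpa using hwb.hasSum_rate)
    rw [wmbQ_diag _ _ (by omega), ← mul_neg]
    simpa using this

lemma hasSum_augQ_row {w b : ℕ → ℝ} {m : ℕ} (hm : m ≠ 1) {x : ℕ × ℕ} {g : ℕ × ℕ → ℝ} {a : ℝ} :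
    HasSum (fun y => if y = x then 0 else augQ w b m x y * g y) a ↔
      HasSum (fun j => if j = x.1 then 0 else wmbQ w b x.1 j * g (jumpTo m x j)) a := by
  rw [← (jumpTo_injective m x).hasSum_iff]
  · refine iff_of_eq (congrArg (fun f => HasSum f a) (funext fun j => ?_))
    simp only [Function.comp_apply, jumpTo_eq_iff hm, augQ_jumpTo]
  · intro y hy
    rw [augQ_eq_zero hy]
    simp

lemma IsWMBData.isConservativeAt_augQ {w b : ℕ → ℝ} (hwb : IsWMBData w b) {m : ℕ} (hm : m ≠ 1)
    (x : ℕ × ℕ) : IsConservativeAt (augQ w b m) x := by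
  constructor
  · intro y hy
    by_cases h : y ∈ Set.range (jumpTo m x)
    · obtain ⟨j, rfl⟩ := h
      rw [augQ_jumpTo]
      exact hwb.wmbQ_nonneg (by rwa [Ne, jumpTo_eq_iff hm] at hy)
    · rw [augQ_eq_zero h]
  · have := (hasSum_augQ_row (w := w) (b := b) (x := x) (g := fun _ => 1) hm).2
      (by simpa using (hwb.isConservativeAt_wmbQ x.1).hasSum)
    rw [augQ_diag _ _ hm]
    simpa using this

/-! ### Bounds for Feller's iterates -/

/-- The indicator of the states with first coordinate `j` and second coordinate at least `k`. -/
def fiberInd (j k : ℕ) (y : ℕ × ℕ) : ℝ := if y.1 = j ∧ k ≤ y.2 then 1 else 0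

lemma fiberInd_mem (j k : ℕ) (y : ℕ × ℕ) : fiberInd j k y ∈ Set.Icc (0 : ℝ) 1 := by
  unfold fiberInd; split_ifs <;> simp

/-- The minimal chain of the first coordinate is dominated by the projection of any `Q`-function
of the augmented matrix. -/
lemma minimalIter_le_act {w b : ℕ → ℝ} (hwb : IsWMBData w b) {m : ℕ} (hm : m ≠ 1)
    {P : ℝ≥0 → ℕ × ℕ → ℕ × ℕ → ℝ} (hP : IsQFunction (augQ w b m) P) (j k : ℕ) (n : ℕ) :
    ∀ (x : ℕ × ℕ) (t : ℝ), k ≤ x.2 → 0 ≤ t →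
      minimalIter (wmbQ w b) n x.1 j t ≤ ENNReal.ofReal (act P t.toNNReal (fiberInd j k) x) := by
  induction n with
  | zero => intros; simp [minimalIter]
  | succ n ih =>
    intro x t hx ht
    refine le_trans ?_ (hP.backward (hwb.isConservativeAt_augQ hm x) (fiberInd_mem j k) ht)
    rw [minimalIter]
    refine add_le_add ?_ ?_
    · split_ifs with h
      · simp [fiberInd, h, hx, augQ_diag _ _ hm]
      · simp
    -- Each jump of the first coordinate lifts to one augmented jump, which never lowers the count,
    -- so the induction hypothesis applies at the target.
    · refine le_trans (ENNReal.tsum_le_tsum fun i => ?_)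
        (ENNReal.tsum_comp_le_tsum_of_injective (jumpTo_injective m x) _)
      simp only [jumpTo_eq_iff hm, augQ_jumpTo, augQ_diag _ _ hm]
      split_ifs with h
      · exact le_rfl
      · refine setLIntegral_mono' measurableSet_Icc fun s hs => ?_
        refine mul_le_mul_right ?_ _
        exact ih (jumpTo m x i) (t - s) (by simp only [jumpTo]; split_ifs <;> omega)
          (by linarith [hs.2])

lemma lintegral_exp_mul_le {c : ℝ} (hc : c < 0) (t : ℝ) :
    ∫⁻ s in Set.Icc 0 t, ENNReal.ofReal (Real.exp (c * s)) ≤ ENNReal.ofReal (-c)⁻¹ := by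
  calc ∫⁻ s in Set.Icc 0 t, ENNReal.ofReal (Real.exp (c * s))
      ≤ ∫⁻ s in Set.Ici 0, ENNReal.ofReal (Real.exp (c * s)) :=
        lintegral_mono_set Set.Icc_subset_Ici_self
    _ = ∫⁻ s in Set.Ioi 0, ENNReal.ofReal (Real.exp (c * s)) :=
        setLIntegral_congr Ioi_ae_eq_Ici.symm
    _ = ENNReal.ofReal (∫ s in Set.Ioi 0, Real.exp (c * s)) :=
        (ofReal_integral_eq_lintegral_ofReal (integrableOn_exp_mul_Ioi hc 0)
          (Eventually.of_forall fun s => (Real.exp_nonneg _))).symm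
    _ = ENNReal.ofReal (-c)⁻¹ := by
        rw [integral_exp_mul_Ioi hc]
        rw [mul_zero, Real.exp_zero, neg_div, one_div, inv_neg]

/-- The minimal chain is absorbed at `0` with probability at most `ρ ^ i` if `ρ` is a root of the
generating function of the rates. -/
lemma minimalIter_zero_le_pow {w b : ℕ → ℝ} (hwb : IsWMBData w b) {ρ : ℝ} (hρ : 0 ≤ ρ)
    (hB : HasSum (fun j : ℕ => b j * ρ ^ j) 0) (n : ℕ) :
    ∀ (i : ℕ) (t : ℝ), 0 ≤ t → minimalIter (wmbQ w b) n i 0 t ≤ ENNReal.ofReal (ρ ^ i) := by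
  induction n with
  | zero => intros; simp [minimalIter]
  | succ n ih =>
    intro i t ht
    rw [minimalIter]
    rcases i with _ | i
    · simp [wmbQ_zero]
    simp only [Nat.add_eq_zero_iff, one_ne_zero, and_false, if_false, zero_add]
    have hc : wmbQ w b (i + 1) (i + 1) < 0 := by
      rw [wmbQ_diag _ _ (by omega)]
      exact mul_neg_of_pos_of_neg (hwb.weight_pos _ (by omega)) (by linarith [hwb.neg_rate_one_pos])
    set c := wmbQ w b (i + 1) (i + 1) with hcdef
    have hrow : HasSum (fun j => if j = i + 1 then 0 else wmbQ w b (i + 1) j * ρ ^ j)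
        (-c * ρ ^ (i + 1)) := by
      -- This is `B(ρ) = 0` multiplied by `ρ ^ i`, with the term `j = 1` moved across.
      have h1 : HasSum (fun j => if j = 1 then 0 else b j * ρ ^ (i + j)) (-b 1 * ρ ^ (i + 1)) := by
        have h2 := (hB.mul_right (ρ ^ i)).sub (hasSum_ite_eq 1 (b 1 * ρ ^ (i + 1)))
        rw [zero_mul, zero_sub, ← neg_mul] at h2
        refine h2.congr_fun fun j => ?_
        split_ifs with h
        · subst h; ring
        · ring
      have h3 := hasSum_wmbQ_row (w := w) (g := fun j => ρ ^ j) h1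
      rwa [hcdef, wmbQ_diag _ _ (by omega), ← mul_neg, mul_assoc]
    have hnn : ∀ j, 0 ≤ if j = i + 1 then 0 else wmbQ w b (i + 1) j * ρ ^ j := fun j => by
      split_ifs with h
      exacts [le_rfl, mul_nonneg (hwb.wmbQ_nonneg h) (pow_nonneg hρ _)]
    calc _ ≤ ∑' j, ENNReal.ofReal (if j = i + 1 then 0 else wmbQ w b (i + 1) j * ρ ^ j) *
          ENNReal.ofReal (-c)⁻¹ := by
          refine ENNReal.tsum_le_tsum fun j => ?_
          split_ifs with h
          · simp
          · have hq := hwb.wmbQ_nonneg (w := w) h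
            -- Bounding the holding-time integral by its full value `1 / (-c)` cancels the factor
            -- `-c` in `hrow`.
            refine le_trans ?_ (mul_le_mul_right (lintegral_exp_mul_le hc t) _)
            rw [← lintegral_const_mul' _ _ ENNReal.ofReal_ne_top]
            refine setLIntegral_mono' measurableSet_Icc fun s hs => ?_
            refine (mul_le_mul_right (ih j (t - s) (by linarith [hs.2])) _).trans (le_of_eq ?_)
            rw [← ENNReal.ofReal_mul (mul_nonneg (Real.exp_nonneg _) hq),
              ← ENNReal.ofReal_mul (mul_nonneg hq (pow_nonneg hρ _))]
            congr 1
            ring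
      _ = ENNReal.ofReal (ρ ^ (i + 1)) := by
          rw [ENNReal.tsum_mul_right, ← ENNReal.ofReal_tsum_of_nonneg hnn hrow.summable,
            hrow.tsum_eq, ← ENNReal.ofReal_mul (mul_nonneg (by linarith) (pow_nonneg hρ _))]
          congr 1
          have := hc.ne
          field_simp

/-! ### Consequences of regularity and vanishing of the harmonic limit -/

section QFunction

variable {w b : ℕ → ℝ} {m : ℕ} {P : ℝ≥0 → ℕ × ℕ → ℕ × ℕ → ℝ}

lemma ofReal_act_fiberInd (hP : IsTransitionFunction P) (t : ℝ≥0) (x : ℕ × ℕ) (j k : ℕ) :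
    ENNReal.ofReal (act P t (fiberInd j k) x) =
      ∑' l, if k ≤ l then ENNReal.ofReal (P t x (j, l)) else 0 := by
  rw [act, ENNReal.ofReal_tsum_of_nonneg
    (fun y => mul_nonneg (hP.nonneg t x y) (fiberInd_mem j k y).1)
    (hP.summable_act (fiberInd_mem j k) t x), ENNReal.tsum_prod', tsum_eq_single j]
  · refine tsum_congr fun l => ?_
    simp only [fiberInd, true_and]
    split_ifs <;> simp
  · intro i hi
    simp [fiberInd, hi]

lemma tsum_ofReal_le_one (hP : IsTransitionFunction P) (t : ℝ≥0) (x : ℕ × ℕ) :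
    ∑' j, ∑' l, ENNReal.ofReal (P t x (j, l)) ≤ 1 := by
  rw [← ENNReal.tsum_prod (f := fun j l => ENNReal.ofReal (P t x (j, l))),
    ← ENNReal.ofReal_tsum_of_nonneg (fun y => hP.nonneg t x y) (hP.summable t x)]
  exact ENNReal.ofReal_le_one.2 (hP.sum_le_one t x)

/-- The restriction `x.2 ≤ l` is kept because it later excludes decreases of the count. -/
lemma minimalQFunction_le (hwb : IsWMBData w b) (hm : m ≠ 1) (hP : IsQFunction (augQ w b m) P)
    (t : ℝ≥0) (x : ℕ × ℕ) (j : ℕ) :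
    minimalQFunction (wmbQ w b) t x.1 j ≤
      ∑' l, if x.2 ≤ l then ENNReal.ofReal (P t x (j, l)) else 0 := by
  rw [← ofReal_act_fiberInd hP.toIsTransitionFunction]
  refine iSup_le fun n => ?_
  simpa using minimalIter_le_act hwb hm hP j x.2 n x t le_rfl t.2

lemma ite_le_tsum (t : ℝ≥0) (x : ℕ × ℕ) (j : ℕ) :
    (∑' l, if x.2 ≤ l then ENNReal.ofReal (P t x (j, l)) else 0) ≤
      ∑' l, ENNReal.ofReal (P t x (j, l)) := by
  refine ENNReal.tsum_le_tsum fun l => ?_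
  split_ifs
  exacts [le_rfl, zero_le]

/-- By regularity, the first coordinate evolves according to the minimal `Q`-function. -/
lemma tsum_eq_minimalQFunction (hwb : IsWMBData w b) (hreg : IsRegular (wmbQ w b)) (hm : m ≠ 1)
    (hP : IsQFunction (augQ w b m) P) (t : ℝ≥0) (x : ℕ × ℕ) (j : ℕ) :
    ∑' l, ENNReal.ofReal (P t x (j, l)) = minimalQFunction (wmbQ w b) t x.1 j := by
  have hle : ∀ j, minimalQFunction (wmbQ w b) t x.1 j ≤ ∑' l, ENNReal.ofReal (P t x (j, l)) :=
    fun j => (minimalQFunction_le hwb hm hP t x j).trans (ite_le_tsum t x j)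
  have hsum := hreg t t.2 x.1
  -- A strict inequality in one column would push the total mass of `P` above `1`.
  by_contra hne
  have hlt := lt_of_le_of_ne (hle j) (Ne.symm hne)
  have := ENNReal.tsum_lt_tsum (by rw [hsum]; simp) hle hlt
  rw [hsum] at this
  exact absurd (tsum_ofReal_le_one hP.toIsTransitionFunction t x) (not_le.2 this)

/-- By regularity, the second coordinate does not decrease. -/
lemma eq_zero_of_snd_lt (hwb : IsWMBData w b) (hreg : IsRegular (wmbQ w b)) (hm : m ≠ 1)
    (hP : IsQFunction (augQ w b m) P) (t : ℝ≥0) {x y : ℕ × ℕ} (hy : y.2 < x.2) :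
    P t x y = 0 := by
  by_contra hne
  have hpos : 0 < P t x y := lt_of_le_of_ne (hP.nonneg t x y) (Ne.symm hne)
  have heq := tsum_eq_minimalQFunction hwb hreg hm hP t x y.1
  have hfin : minimalQFunction (wmbQ w b) t x.1 y.1 ≠ ∞ :=
    ((ENNReal.le_tsum y.1).trans_eq (hreg t t.2 x.1)).trans_lt (by simp) |>.ne
  have h1 := minimalQFunction_le hwb hm hP t x y.1
  -- Mass below the level `x.2` would make the restricted sum strictly smaller than the minimal
  -- `Q`-function, which it dominates.
  have hlt := ENNReal.tsum_lt_tsum (i := y.2)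
    (f := fun l => if x.2 ≤ l then ENNReal.ofReal (P t x (y.1, l)) else 0)
    (g := fun l => ENNReal.ofReal (P t x (y.1, l)))
    (ne_top_of_le_ne_top (heq ▸ hfin) (ite_le_tsum t x y.1))
    (fun l => by
      split_ifs
      exacts [le_rfl, zero_le]) (by
      simp only [if_neg (not_le.2 hy)]
      exact ENNReal.ofReal_pos.2 hpos)
  rw [heq] at hlt
  exact absurd h1 (not_le.2 hlt)

lemma tsum_zero_le_pow (hwb : IsWMBData w b) (hreg : IsRegular (wmbQ w b)) (hm : m ≠ 1)
    (hP : IsQFunction (augQ w b m) P) {ρ : ℝ} (hρ : 0 ≤ ρ)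
    (hB : HasSum (fun j : ℕ => b j * ρ ^ j) 0) (t : ℝ≥0) (x : ℕ × ℕ) :
    ∑' l, ENNReal.ofReal (P t x (0, l)) ≤ ENNReal.ofReal (ρ ^ x.1) := by
  rw [tsum_eq_minimalQFunction hwb hreg hm hP]
  exact iSup_le fun n => minimalIter_zero_le_pow hwb hρ hB n _ _ t.2

/-- The states with first coordinate `0` are absorbing. -/
lemma absorbing (hm : m ≠ 1) (hP : IsQFunction (augQ w b m) P) (t : ℝ≥0) {x : ℕ × ℕ}
    (hx : x.1 = 0) : P t x x = 1 :=
  hP.diag_eq_one (by rw [augQ_diag _ _ hm, hx, wmbQ_zero]) t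

/-- The indicator of the states with nonzero first coordinate and second coordinate at
most `N`. -/
def aliveInd (N : ℕ) (y : ℕ × ℕ) : ℝ := if y.1 ≠ 0 ∧ y.2 ≤ N then 1 else 0

lemma aliveInd_mem (N : ℕ) (y : ℕ × ℕ) : aliveInd N y ∈ Set.Icc (0 : ℝ) 1 := by
  unfold aliveInd; split_ifs <;> simp

lemma act_aliveInd_of_fst_eq_zero (hm : m ≠ 1) (hP : IsQFunction (augQ w b m) P) (N : ℕ)
    (t : ℝ≥0) {x : ℕ × ℕ} (hx : x.1 = 0) : act P t (aliveInd N) x = 0 := by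
  refine (tsum_congr fun y => ?_).trans tsum_zero
  by_cases h : y = x
  · simp [h, aliveInd, hx]
  · rw [hP.toIsTransitionFunction.eq_zero_of_diag (absorbing hm hP t hx) h, zero_mul]

lemma act_aliveInd_of_lt_snd (hwb : IsWMBData w b) (hreg : IsRegular (wmbQ w b)) (hm : m ≠ 1)
    (hP : IsQFunction (augQ w b m) P) {N : ℕ} (t : ℝ≥0) {x : ℕ × ℕ} (hx : N < x.2) :
    act P t (aliveInd N) x = 0 := by
  refine (tsum_congr fun y => ?_).trans tsum_zero
  by_cases h : y.2 ≤ N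
  · rw [eq_zero_of_snd_lt hwb hreg hm hP t (h.trans_lt hx), zero_mul]
  · simp [aliveInd, h]

/-- The states where `aliveInd N` vanishes cannot be left, so `act P r (aliveInd N) ≤ aliveInd N`.
-/
lemma antitone_act_aliveInd (hwb : IsWMBData w b) (hreg : IsRegular (wmbQ w b)) (hm : m ≠ 1)
    (hP : IsQFunction (augQ w b m) P) (N : ℕ) (x : ℕ × ℕ) :
    Antitone fun t => act P t (aliveInd N) x := by
  intro t s hts
  obtain ⟨r, rfl⟩ := exists_add_of_le hts
  have hT := hP.toIsTransitionFunction
  simp only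
  rw [hT.act_add (aliveInd_mem N)]
  refine hT.act_mono (fun y => hT.act_mem (aliveInd_mem N) r y) (aliveInd_mem N) (fun y => ?_) t x
  by_cases h0 : y.1 = 0
  · rw [act_aliveInd_of_fst_eq_zero hm hP N r h0]
    exact (aliveInd_mem N y).1
  by_cases hN : y.2 ≤ N
  · rw [aliveInd, if_pos ⟨h0, hN⟩]
    exact (hT.act_mem (aliveInd_mem N) r y).2
  · rw [act_aliveInd_of_lt_snd hwb hreg hm hP r (not_le.1 hN)]
    exact (aliveInd_mem N y).1

/-- A bounded function that is invariant under `P` is harmonic for `q`. -/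
lemma IsQFunction.harmonic_of_invariant {S : Type*} [DecidableEq S] {q : S → S → ℝ}
    {P : ℝ≥0 → S → S → ℝ} (hP : IsQFunction q P) {x : S} (hq : IsConservativeAt q x) {f : S → ℝ}
    (hf : ∀ x, f x ∈ Set.Icc (0 : ℝ) 1) (hinv : ∀ r, act P r f x = f x) :
    gain q f x = -q x x * f x := by
  have h := hP.tendsto_act_sub_div hq hf
  simp only [hinv, sub_self, zero_div] at h
  linarith [tendsto_nhds_unique h tendsto_const_nhds]

/-- A bounded nonnegative harmonic function vanishing where the first coordinate is `0` or the
second one is large vanishes everywhere. -/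
lemma eq_zero_of_harmonic (hwb : IsWMBData w b) (hbm : 0 < b m) (hm : m ≠ 1) {f : ℕ × ℕ → ℝ}
    (hf : ∀ x, f x ∈ Set.Icc (0 : ℝ) 1)
    (hharm : ∀ x, gain (augQ w b m) f x = -augQ w b m x x * f x)
    (h0 : ∀ x : ℕ × ℕ, x.1 = 0 → f x = 0) {N : ℕ} (hN : ∀ x : ℕ × ℕ, N < x.2 → f x = 0)
    (x : ℕ × ℕ) : f x = 0 := by
  have key : ∀ k, (∀ i, f (i, k + 1) = 0) → ∀ i, f (i, k) = 0 := by
    intro k hk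
    have hbdd : BddAbove (Set.range fun i => f (i, k)) :=
      ⟨1, by rintro _ ⟨i, rfl⟩; exact (hf _).2⟩
    set M := ⨆ i, f (i, k) with hM
    have hle : ∀ i, f (i, k) ≤ M := fun i => le_ciSup hbdd i
    have hM0 : 0 ≤ M := (hf (0, k)).1.trans (hle 0)
    have hstep : ∀ i, f (i, k) * -b 1 ≤ M * (-b 1 - b m) := by
      intro i
      have hbm1 : b m ≤ -b 1 := by
        have := hwb.hasSum_rate.summable.le_tsum m fun j _ => by
          split_ifs with h
          exacts [le_rfl, hwb.rate_nonneg j h]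
        rwa [hwb.hasSum_rate.tsum_eq, if_neg hm] at this
      rcases i with _ | i
      · rw [h0 (0, k) rfl, zero_mul]
        exact mul_nonneg hM0 (by linarith)
      have hs : HasSum (fun j => if j = 1 then 0 else if j = m then 0 else b j * M)
          (M * (-b 1 - b m)) := by
        have := (hwb.hasSum_rate.sub (hasSum_ite_eq m (b m))).mul_left M
        refine this.congr_fun fun j => ?_
        split_ifs with h1 h2 h2
        · omega
        · simp
        · simp [h2]
        · ring
      -- The comparison row has the rate at `m` deleted: marked jumps land on level `k + 1`, where
      -- `f` is zero.
      have hs' := hasSum_wmbQ_row (w := w) (b := fun j => if j = m then 0 else b j)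
        (g := fun _ => M) (i := i) (a := M * (-b 1 - b m)) (by
          refine hs.congr_fun fun j => ?_
          split_ifs <;> simp)
      have hg := (hasSum_augQ_row (g := f) hm).1
        ((hwb.isConservativeAt_augQ hm (i + 1, k)).summable_gain hf).hasSum
      change HasSum _ (gain (augQ w b m) f (i + 1, k)) at hg
      rw [hharm, augQ_diag _ _ hm] at hg
      simp only [wmbQ_diag _ _ (Nat.le_add_left 1 i)] at hg
      have hfin := hasSum_le (fun j => ?_) hg hs'
      · have hw := hwb.weight_pos (i + 1) (by omega)
        refine le_of_mul_le_mul_left ?_ hw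
        linarith
      · split_ifs with hj
        · exact le_rfl
        by_cases hjm : j + 1 - (i + 1) = m
        · have h1 : f (jumpTo m (i + 1, k) j) = 0 := by simp [jumpTo, hjm, hk]
          rw [h1, mul_zero]
          refine mul_nonneg ?_ hM0
          simp [wmbQ, hjm]
        · have h1 : jumpTo m (i + 1, k) j = (j, k) := by simp only [jumpTo, if_neg hjm]
          have h2 : wmbQ w (fun j => if j = m then 0 else b j) (i + 1) j = wmbQ w b (i + 1) j := by
            simp only [wmbQ, if_neg hjm]
          rw [h1, h2]
          exact mul_le_mul_of_nonneg_left (hle j) (hwb.wmbQ_nonneg hj)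
    have hM1 : M * -b 1 ≤ M * (-b 1 - b m) := by
      have hb1 := hwb.neg_rate_one_pos
      rw [← le_div_iff₀ hb1]
      exact ciSup_le fun i => (le_div_iff₀ hb1).2 (hstep i)
    have hM2 : M ≤ 0 := by
      by_contra h
      nlinarith [mul_pos (not_le.1 h) hbm]
    exact fun i => le_antisymm ((hle i).trans hM2) (hf _).1
  have hdesc : ∀ d k, N < k + d → ∀ i, f (i, k) = 0 := by
    intro d
    induction d with
    | zero => exact fun k hk i => hN (i, k) hk
    | succ d ih => exact fun k hk => key k (ih (k + 1) (by omega))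
  exact hdesc (N + 1) x.2 (by omega) x.1

/-- The probability of being alive with at most `N` marked jumps tends to `0`. -/
lemma tendsto_act_aliveInd (hwb : IsWMBData w b) (hreg : IsRegular (wmbQ w b)) (hbm : 0 < b m)
    (hm : m ≠ 1) (hP : IsQFunction (augQ w b m) P) (N : ℕ) (x : ℕ × ℕ) :
    Tendsto (fun t => act P t (aliveInd N) x) atTop (𝓝 0) := by
  have hT := hP.toIsTransitionFunction
  have hmem : ∀ t y, act P t (aliveInd N) y ∈ Set.Icc (0 : ℝ) 1 := fun t y =>
    hT.act_mem (aliveInd_mem N) t y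
  have hlim : ∀ y, Tendsto (fun t => act P t (aliveInd N) y) atTop
      (𝓝 (⨅ t, act P t (aliveInd N) y)) := fun y =>
    tendsto_atTop_ciInf (antitone_act_aliveInd hwb hreg hm hP N y)
      ⟨0, by rintro _ ⟨t, rfl⟩; exact (hmem t y).1⟩
  set f : ℕ × ℕ → ℝ := fun y => ⨅ t, act P t (aliveInd N) y with hfdef
  have hf : ∀ y, f y ∈ Set.Icc (0 : ℝ) 1 := fun y =>
    isClosed_Icc.mem_of_tendsto (hlim y) (Eventually.of_forall fun t => hmem t y)
  have hinv : ∀ r y, act P r f y = f y := by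
    intro r y
    -- Invariance of the limit: dominated convergence with the summable bound `P r y`, against the
    -- shift `r + t` of time.
    have h1 : Tendsto (fun t => act P r (act P t (aliveInd N)) y) atTop (𝓝 (act P r f y)) :=
      tendsto_tsum_of_dominated_convergence (hT.summable r y)
        (fun z => (hlim z).const_mul (P r y z))
        (Eventually.of_forall fun t z => by
          rw [Real.norm_of_nonneg (mul_nonneg (hT.nonneg r y z) (hmem t z).1)]
          exact mul_le_of_le_one_right (hT.nonneg r y z) (hmem t z).2)
    have h2 : Tendsto (fun t => act P (r + t) (aliveInd N) y) atTop (𝓝 (f y)) :=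
      (hlim y).comp (tendsto_atTop_mono (fun t => le_add_self) tendsto_id)
    refine tendsto_nhds_unique h1 (h2.congr fun t => ?_)
    rw [hT.act_add (aliveInd_mem N)]
  have hzero := eq_zero_of_harmonic hwb hbm hm hf
    (fun y => hP.harmonic_of_invariant (hwb.isConservativeAt_augQ hm y) hf fun r => hinv r y)
    (fun y hy => by simp [hfdef, act_aliveInd_of_fst_eq_zero hm hP N _ hy])
    (N := N) (fun y hy => by simp [hfdef, act_aliveInd_of_lt_snd hwb hreg hm hP _ hy]) x
  have := hlim x
  rwa [show (⨅ t, act P t (aliveInd N) x) = 0 from hzero] at this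

end QFunction

end

lemma extinctionTime_eq_top_iff {Ω : Type*} {X : ℝ≥0 → Ω → ℕ} {ω : Ω} :
    extinctionTime X ω = ∞ ↔ ∀ t, X t ω ≠ 0 := by
  simp [extinctionTime]

/-! ### From transition probabilities to paths -/

section MarkovChain

variable {Ω : Type*} [MeasurableSpace Ω] {μ : Measure Ω}

namespace IsMarkovChain

variable {S : Type*} [MeasurableSpace S] [TopologicalSpace S]
  {P : ℝ≥0 → S → S → ℝ} {Z : ℝ≥0 → Ω → S}

lemma real_two_times (h : IsMarkovChain μ P Z) {s t : ℝ≥0} (hst : s ≤ t) (x y : S) :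
    μ.real {ω | Z s ω = x ∧ Z t ω = y} = μ.real {ω | Z s ω = x} * P (t - s) x y := by
  have hm : Monotone fun k : ℕ => if k = 0 then s else t := by
    intro i j hij
    simp only
    split_ifs
    exacts [le_rfl, hst, by omega, le_rfl]
  have := h.markov 0 (fun k => if k = 0 then s else t) (fun k => if k = 0 then x else y) hm
  have h1 : {ω | ∀ k ≤ 0 + 1, Z (if k = 0 then s else t) ω = if k = 0 then x else y} =
      {ω | Z s ω = x ∧ Z t ω = y} := by
    ext ω
    refine ⟨fun H => ⟨H 0 (by simp), H 1 (by simp)⟩, fun H k hk => ?_⟩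
    rcases k with _ | k
    exacts [H.1, H.2]
  have h2 : {ω | ∀ k ≤ 0, Z (if k = 0 then s else t) ω = if k = 0 then x else y} =
      {ω | Z s ω = x} := by
    ext ω
    refine ⟨fun H => H 0 le_rfl, fun H k hk => ?_⟩
    obtain rfl := Nat.le_zero.1 hk
    exact H
  simpa only [h1, h2, zero_add, one_ne_zero, if_true, if_false] using this

variable [IsProbabilityMeasure μ]

lemma measure_eq (h : IsMarkovChain μ P Z) {x₀ : S} (h0 : ∀ᵐ ω ∂μ, Z 0 ω = x₀) (t : ℝ≥0) (y : S) :
    μ {ω | Z t ω = y} = ENNReal.ofReal (P t x₀ y) := by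
  have h1 := h.real_two_times (zero_le (a := t)) x₀ y
  have h2 : μ.real {ω | Z 0 ω = x₀} = 1 := by
    simp [Measure.real, measure_congr (eventuallyEq_univ.2 h0)]
  have h3 : {ω | Z 0 ω = x₀ ∧ Z t ω = y} =ᵐ[μ] {ω | Z t ω = y} := by
    filter_upwards [h0] with ω hω
    exact propext (and_iff_right hω)
  rw [h2, one_mul, tsub_zero, measureReal_congr h3] at h1
  rw [← h1, ofReal_measureReal]

lemma measure_mem_le [Countable S] (h : IsMarkovChain μ P Z) {x₀ : S}
    (h0 : ∀ᵐ ω ∂μ, Z 0 ω = x₀) (t : ℝ≥0) (p : S → Prop) [DecidablePred p] :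
    μ {ω | p (Z t ω)} ≤ ∑' y, if p y then ENNReal.ofReal (P t x₀ y) else 0 := by
  have hsub : {ω | p (Z t ω)} ⊆ ⋃ y, {ω | Z t ω = y ∧ p y} := fun ω hω =>
    Set.mem_iUnion.2 ⟨Z t ω, rfl, hω⟩
  refine (measure_mono hsub).trans ((measure_iUnion_le _).trans (ENNReal.tsum_le_tsum fun y => ?_))
  split_ifs with hy
  · simp only [hy, and_true]
    exact (h.measure_eq h0 t y).le
  · simp [hy]

/-- A relation that holds along all transitions of positive probability holds along almost every
path. -/
lemma ae_forall_lt [Countable S] [DiscreteTopology S] (h : IsMarkovChain μ P Z) {R : S → S → Prop}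
    (hR : ∀ t x y, ¬ R x y → P t x y = 0) : ∀ᵐ ω ∂μ, ∀ s t, s < t → R (Z s ω) (Z t ω) := by
  obtain ⟨D, hDc, hD⟩ := TopologicalSpace.exists_countable_dense ℝ≥0
  have hae : ∀ᵐ ω ∂μ, ∀ s ∈ D, ∀ t ∈ D, s ≤ t → R (Z s ω) (Z t ω) := by
    refine (ae_ball_iff hDc).2 fun s _ => (ae_ball_iff hDc).2 fun t _ => ?_
    by_cases hst : s ≤ t
    · have : ∀ᵐ ω ∂μ, ∀ x y, ¬ R x y → ¬ (Z s ω = x ∧ Z t ω = y) := by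
        refine ae_all_iff.2 fun x => ae_all_iff.2 fun y => ?_
        by_cases hxy : R x y
        · simp [hxy]
        · have h1 := h.real_two_times hst x y
          rw [hR _ _ _ hxy, mul_zero, measureReal_eq_zero_iff] at h1
          filter_upwards [measure_eq_zero_iff_ae_notMem.1 h1] with ω hω _ using hω
      filter_upwards [this] with ω hω _
      by_contra hc
      exact hω _ _ hc ⟨rfl, rfl⟩
    · simp [hst]
  filter_upwards [hae, h.rightContinuous] with ω hω hrc s t hst
  -- A right-continuous path in a discrete space is constant just after `s`, so its value there is
  -- also taken at a later point of `D`. The bound by `u` keeps the replacement times for `s` and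
  -- `t` in order.
  have hstep : ∀ s u : ℝ≥0, s < u → ∃ s' ∈ D, s < s' ∧ s' < u ∧ Z s' ω = Z s ω := by
    intro s u hsu
    have h1 : ∀ᶠ r in 𝓝[>] s, Z r ω = Z s ω :=
      ((hrc s).eventually (by simp [nhds_discrete] : {Z s ω} ∈ 𝓝 (Z s ω))).filter_mono
        (nhdsWithin_mono _ Set.Ioi_subset_Ici_self)
    obtain ⟨v, hv, hv'⟩ := (mem_nhdsGT_iff_exists_Ioo_subset' hsu).1 h1
    obtain ⟨s', hs'D, hs'⟩ := hD.exists_between (lt_min (Set.mem_Ioi.1 hv) hsu)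
    exact ⟨s', hs'D, hs'.1, hs'.2.trans_le (min_le_right _ _),
      hv' ⟨hs'.1, hs'.2.trans_le (min_le_left _ _)⟩⟩
  obtain ⟨s', hs'D, -, hs't, hs'⟩ := hstep s t hst
  obtain ⟨t', ht'D, htt', -, ht'⟩ := hstep t (t + 1) (by simp)
  rw [← hs', ← ht']
  exact hω s' hs'D t' ht'D (hs't.trans htt').le

end IsMarkovChain

end MarkovChain

end WMB

/-! ### The main theorem -/

theorem theorem3p3 (w b : ℕ → ℝ) (hwb : WMB.IsWMBData w b)
    (hreg : WMB.IsRegular (WMB.wmbQ w b))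
    (ρ : ℝ) (hρ : IsLeast {u : ℝ | 0 ≤ u ∧ HasSum (fun j : ℕ => b j * u ^ j) 0} ρ) (hρ1 : ρ < 1)
    (m : ℕ) (hm : 0 < b m)
    {Ω : Type*} [MeasurableSpace Ω] (μ : Measure Ω) [IsProbabilityMeasure μ]
    (P : ℝ≥0 → ℕ × ℕ → ℕ × ℕ → ℝ) (hP : WMB.IsQFunction (WMB.augQ w b m) P)
    (X Y : ℝ≥0 → Ω → ℕ)
    (hXY : WMB.IsMarkovChain μ P (fun t ω => (X t ω, Y t ω)))
    (h0 : ∀ᵐ ω ∂μ, X 0 ω = 1 ∧ Y 0 ω = 0) :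
    ProbabilityTheory.cond μ {ω | WMB.extinctionTime X ω = ∞}
      {ω | Tendsto (fun t => Y t ω) atTop atTop} = 1 := by
  have hm1 : m ≠ 1 := fun h => by
    have := hwb.neg_rate_one_pos
    rw [h] at hm
    linarith
  have hT := hP.toIsTransitionFunction
  have hinit : ∀ᵐ ω ∂μ, (X 0 ω, Y 0 ω) = (1, 0) := h0.mono fun ω h => Prod.ext h.1 h.2
  have hpath : ∀ᵐ ω ∂μ, ∀ s t, s < t → Y s ω ≤ Y t ω ∧ (X s ω = 0 → X t ω = 0) := by
    refine hXY.ae_forall_lt (R := fun x y => x.2 ≤ y.2 ∧ (x.1 = 0 → y.1 = 0)) fun t x y hxy => ?_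
    by_cases h2 : x.2 ≤ y.2
    · have h1 : x.1 = 0 ∧ y.1 ≠ 0 := by simpa [h2] using hxy
      exact hT.eq_zero_of_diag (WMB.absorbing hm1 hP t h1.1) fun h => h1.2 (h ▸ h1.1)
    · exact WMB.eq_zero_of_snd_lt hwb hreg hm1 hP t (not_le.1 h2)
  have hmeas : ∀ t, MeasurableSet {ω | X t ω = 0} := fun t =>
    (measurable_fst.comp (hXY.measurable t)) (measurableSet_singleton 0)
  -- State `0` is absorbing, so survival is almost surely decided at integer times; `D` is moreover
  -- measurable, as `cond_apply` requires.
  set D : Set Ω := (⋃ n : ℕ, {ω | X n ω = 0})ᶜ with hDdef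
  have hD : MeasurableSet D := (MeasurableSet.iUnion fun n : ℕ => hmeas n).compl
  have hmemD : ∀ ω, ω ∈ D ↔ ∀ n : ℕ, X n ω ≠ 0 := fun ω => by simp [hDdef]
  have hsurv : {ω | WMB.extinctionTime X ω = ∞} =ᵐ[μ] D := by
    filter_upwards [hpath] with ω hω
    refine propext (WMB.extinctionTime_eq_top_iff.trans ⟨fun h => (hmemD ω).2 fun n => h n,
      fun h t ht => ?_⟩)
    obtain ⟨n, hn⟩ := exists_nat_gt t
    exact (hmemD ω).1 h n ((hω t n hn).2 ht)
  have hDpos : μ D ≠ 0 := by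
    have hle : μ (⋃ n : ℕ, {ω | X n ω = 0}) ≤ ENNReal.ofReal ρ := by
      -- The extinction events increase with `n` only almost surely, hence the passage through
      -- accumulated unions.
      rw [measure_iUnion_eq_iSup_accumulate]
      refine iSup_le fun n => ?_
      calc μ (Set.accumulate (fun n : ℕ => {ω | X n ω = 0}) n) ≤ μ {ω | X n ω = 0} := by
            refine measure_mono_ae ?_
            filter_upwards [hpath] with ω hω h
            obtain ⟨k, hk, hk'⟩ := Set.mem_accumulate.1 h
            rcases hk.eq_or_lt with rfl | hlt
            · exact hk'
            · exact (hω k n (by exact_mod_cast hlt)).2 hk'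
        _ ≤ ∑' y : ℕ × ℕ, if y.1 = 0 then ENNReal.ofReal (P n (1, 0) y) else 0 :=
            hXY.measure_mem_le hinit n (fun y => y.1 = 0)
        _ = ∑' l, ENNReal.ofReal (P n (1, 0) (0, l)) := by
            rw [ENNReal.tsum_prod', tsum_eq_single 0]
            · simp
            · intro i hi
              simp [hi]
        _ ≤ ENNReal.ofReal ρ := by
            simpa using WMB.tsum_zero_le_pow hwb hreg hm1 hP hρ.1.1 hρ.1.2 n (1, 0)
    intro h
    rw [hDdef, prob_compl_eq_zero_iff (MeasurableSet.iUnion fun n : ℕ => hmeas n)] at h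
    rw [h] at hle
    exact absurd (ENNReal.one_le_ofReal.1 hle) (not_le.2 hρ1)
  have htend : ∀ᵐ ω ∂μ, ω ∈ D → Tendsto (fun t => Y t ω) atTop atTop := by
    have hN : ∀ᵐ ω ∂μ, ∀ N : ℕ, ω ∉ {ω | ∀ n : ℕ, X n ω ≠ 0 ∧ Y n ω ≤ N} := by
      refine ae_all_iff.2 fun N => measure_eq_zero_iff_ae_notMem.1 (le_antisymm ?_ zero_le)
      have hlim := ENNReal.tendsto_ofReal
        ((WMB.tendsto_act_aliveInd hwb hreg hm hm1 hP N (1, 0)).comp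
          (tendsto_natCast_atTop_atTop (R := ℝ≥0)))
      rw [ENNReal.ofReal_zero] at hlim
      refine ge_of_tendsto' hlim fun n => ?_
      calc μ {ω | ∀ n : ℕ, X n ω ≠ 0 ∧ Y n ω ≤ N} ≤ μ {ω | X n ω ≠ 0 ∧ Y n ω ≤ N} :=
            measure_mono fun ω h => h n
        _ ≤ ∑' y : ℕ × ℕ, if y.1 ≠ 0 ∧ y.2 ≤ N then ENNReal.ofReal (P n (1, 0) y) else 0 :=
            hXY.measure_mem_le hinit n (fun y => y.1 ≠ 0 ∧ y.2 ≤ N)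
        _ = ENNReal.ofReal (WMB.act P n (WMB.aliveInd N) (1, 0)) := by
            rw [WMB.act, ENNReal.ofReal_tsum_of_nonneg
              (fun y => mul_nonneg (hT.nonneg _ _ y) (WMB.aliveInd_mem N y).1)
              (hT.summable_act (WMB.aliveInd_mem N) _ _)]
            refine tsum_congr fun y => ?_
            unfold WMB.aliveInd
            split_ifs <;> simp
    filter_upwards [hpath, hN] with ω hω hωN hωD
    have hmono : Monotone fun t => Y t ω := fun s t hst => by
      rcases hst.eq_or_lt with rfl | hlt
      exacts [le_rfl, (hω s t hlt).1]
    -- A monotone path that does not diverge stays below some `N`, which `hN` rules out on `D`.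
    refine tendsto_atTop_atTop_of_monotone hmono fun N => ?_
    by_contra! hc
    exact hωN N fun n => ⟨(hmemD ω).1 hωD n, (hc n).le⟩
  have hcond : ProbabilityTheory.cond μ {ω | WMB.extinctionTime X ω = ∞} =
      ProbabilityTheory.cond μ D := by
    rw [ProbabilityTheory.cond, ProbabilityTheory.cond, measure_congr hsurv,
      Measure.restrict_congr_set hsurv]
  rw [hcond, cond_apply hD]
  have hinter : (D ∩ {ω | Tendsto (fun t => Y t ω) atTop atTop} : Set Ω) =ᵐ[μ] D := by
    filter_upwards [htend] with ω hω
    exact propext ⟨fun h => h.1, fun h => ⟨h, hω h⟩⟩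
  rw [measure_congr hinter]
  exact ENNReal.inv_mul_cancel hDpos (measure_ne_top μ D)
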